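/- **Setting.** An arena consists of a finite set $\Pi$ of players, a finite set $V$ of vertices, a set $E\subseteq V\times V$ of edges such that every vertex has a successor, and a partition $(V_i)_{i\in\Pi}$ of $V$ (player $i$ owns $V_i$; some $V_i$ may be empty). A play is an infinite path $\rho=\rho_0\rho_1\ldots$; a history is a finite nonempty path, and its length is its number of edges. A quantitative reachability game $\mathcal G$ is an arena with target sets $F_i\subseteq V$ $(i\in\Pi)$; $\mathrm{Cost}_i(\rho)$ is the least $k$ with $\rho_k\in F_i$, and $+\infty$ if there is none; $\mathrm{Visit}(\rho)$ is the set of players $i$ such that $\rho$ visits $F_i$. A strategy of player $i$ maps each history ending in $v\in V_i$ to a successor of $v$; $\langle\sigma\rangle_{v}$ is the play from $v$ in which all players follow the strategy profile $\sigma$. A profile $\sigma$ is a Nash equilibrium (NE) from $v_0$ if no player can strictly decrease his cost by a unilateral change of strategy. It is a subgame perfect equilibrium (SPE) from $v_0$ if, for every history $hv$ starting in $v_0$, the profile $h'\mapsto\sigma(hh')$ is an NE from $v$ for the cost functions $\rho\mapsto\mathrm{Cost}_i(h\rho)$. A cost profile is Pareto optimal in $\mathrm{Plays}(v_0)$ if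 it is minimal for the componentwise order among the cost profiles of the plays from $v_0$. A lasso is a play $h\ell^\omega$ with $\ell$ nonempty and $h\ell$ a history; $h$ may be empty. The extended game $\mathcal X$ of $\mathcal G$ is the quantitative reachability game with the same players, vertex set $V\times 2^\Pi$, edges $((v,I),(v',I'))$ where $(v,v')\in E$ and $I'=I\cup\{i : v'\in F_i\}$, with $(v,I)$ owned by the owner of $v$, and with target sets $\{(v,I) : i\in I\}$. For $v_0\in V$ put $x_0=(v_0,\{i : v_0\in F_i\})$. **Proposition.** Let $\mathcal G$ be a quantitative reachability game, $v_0\in V$, and let $\mathcal X$, $x_0$ be as above. Let $\sigma$ be an NE in $(\mathcal G,v_0)$ and $w_0=v_0$ (resp. an SPE in $(\mathcal X,x_0)$ and $w_0=x_0$). If $(\mathrm{Cost}_i(\langle\sigma\rangle_{w_0}))_{i\in\Pi}$ is Pareto optimal in $\mathrm{Plays}(w_0)$, then: * for all $i\in\mathrm{Visit}(\langle\sigma\rangle_{w_0})$, $\mathrm{Cost}_i(\langle\sigma\rangle_{w_0})\le|V|\cdot|\Pi|$; * there exists an NE in $(\mathcal G,v_0)$ (resp. an SPE in $(\mathcal X,x_0)$)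 $\tau$ such that $\langle\tau\rangle_{w_0}=h\ell^\omega$ is a lasso with $|h\ell|\le(|\Pi|+1)\cdot|V|$ and $(\mathrm{Cost}_i(\langle\sigma\rangle_{w_0}))_{i\in\Pi}=(\mathrm{Cost}_i(\langle\tau\rangle_{w_0}))_{i\in\Pi}$. In both cases $V$ is the vertex set of $\mathcal G$, not that of $\mathcal X$. -/

import Mathlib

/-- An arena with set of players `P` and set of vertices `V`. The partition `(V_i)` of the vertices
is given by the map sending a vertex to the player who owns it. Finiteness of `P` and `V` is
assumed where it is used. -/
structure Arena (P V : Type*) where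
  Edge : V → V → Prop
  exists_edge : ∀ v, ∃ w, Edge v w
  owner : V → P

namespace Arena

variable {P V : Type*}

/-- Plays are infinite paths. -/
def IsPlay (A : Arena P V) (ρ : ℕ → V) : Prop :=
  ∀ k, A.Edge (ρ k) (ρ (k + 1))

/-- The set of plays starting in `v₀`. -/
def playsFrom (A : Arena P V) (v₀ : V) : Set (ℕ → V) :=
  {ρ | A.IsPlay ρ ∧ ρ 0 = v₀}

/-- Histories are finite nonempty paths, written as lists of vertices. -/
def IsHist (A : Arena P V) (h : List V) : Prop :=
  h ≠ [] ∧ h.IsChain A.Edge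

/-- Histories starting in `v₀`. -/
def IsHistFrom (A : Arena P V) (v₀ : V) (h : List V) : Prop :=
  A.IsHist h ∧ h.head? = some v₀

/-- A strategy of player `i`: `next h v` is the vertex chosen after the history `hv`, when `v` is
a vertex of player `i`. Only the values at histories `hv` with `v` owned by `i` ever matter; a
strategy given on those histories only extends to all lists, as every vertex has a successor. -/
structure Strategy (A : Arena P V) (i : P) where
  next : List V → V → V
  legal : ∀ h v, A.owner v = i → A.Edge v (next h v)

/-- A strategy profile: one strategy for each player. -/
abbrev Profile (A : Arena P V) : Type _ := (i : P) → A.Strategy i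

/-- The strategy `σ_i` restricted to the histories that extend `h`: `h' ↦ σ_i (h h')`. -/
def Strategy.restrict {A : Arena P V} {i : P} (s : A.Strategy i) (h : List V) : A.Strategy i where
  next h' v := s.next (h ++ h') v
  legal h' v hv := s.legal (h ++ h') v hv

/-- The profile obtained from `σ` by restricting every strategy to the histories extending `h`. -/
def Profile.restrict {A : Arena P V} (σ : A.Profile) (h : List V) : A.Profile :=
  fun i => (σ i).restrict h

/-- The vertices visited strictly before step `n`, and the vertex reached at step `n`, when all
players follow `σ` from `v₀`. -/
def Profile.run {A : Arena P V} (σ : A.Profile) (v₀ : V) : ℕ → List V × V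
  | 0 => ([], v₀)
  | n + 1 =>
    let s := Profile.run σ v₀ n
    (s.1 ++ [s.2], (σ (A.owner s.2)).next s.1 s.2)

/-- The outcome of `σ` from `v₀`: the play from `v₀` consistent with all strategies of `σ`. -/
def Profile.outcome {A : Arena P V} (σ : A.Profile) (v₀ : V) : ℕ → V :=
  fun n => (σ.run v₀ n).2

end Arena

/-- The infinite sequence `hρ`. -/
def prepend {V : Type*} (h : List V) (ρ : ℕ → V) : ℕ → V :=
  fun n => if hn : n < h.length then h[n] else ρ (n - h.length)

/-- The infinite sequence `ℓ^ω`, for a nonempty finite sequence `ℓ`. -/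
def omegaPow {V : Type*} (l : List V) (hl : l ≠ []) : ℕ → V :=
  fun n => l[n % l.length]'(Nat.mod_lt n (List.length_pos_of_ne_nil hl))

/-- The length of a history is its number of edges. -/
def histLength {V : Type*} (h : List V) : ℕ := h.length - 1

/-- `ρ` is the lasso `hℓ^ω`, with `hℓ` a history (`h` may be empty, `ℓ` may not). -/
def Arena.IsLasso {P V : Type*} (A : Arena P V) (ρ : ℕ → V) (h l : List V) : Prop :=
  A.IsHist (h ++ l) ∧ ∃ hl : l ≠ [], ρ = prepend h (omegaPow l hl)

/-- A game: an arena with a cost function for each player. -/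
structure Game (P V : Type*) extends Arena P V where
  cost : P → (ℕ → V) → ℕ∞

namespace Game

variable {P V : Type*}

/-- The cost profile of a play. -/
def costProfile (G : Game P V) (ρ : ℕ → V) : P → ℕ∞ :=
  fun i => G.cost i ρ

/-- The game with cost functions `ρ ↦ Cost_i (hρ)`. -/
def restrict (G : Game P V) (h : List V) : Game P V where
  toArena := G.toArena
  cost i ρ := G.cost i (prepend h ρ)

open Classical in
/-- `σ` is a Nash equilibrium of `(G, v₀)`: no player has a profitable deviation. -/
def IsNE (G : Game P V) (v₀ : V) (σ : G.toArena.Profile) : Prop :=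
  ∀ (i : P) (s : G.toArena.Strategy i),
    G.cost i (σ.outcome v₀) ≤
      G.cost i (Arena.Profile.outcome (A := G.toArena) (Function.update σ i s) v₀)

/-- `σ` is a subgame perfect equilibrium of `(G, v₀)`: for each history `hv` starting in `v₀`,
the restriction of `σ` to `h` is a Nash equilibrium of the subgame of `G` after `h`, from `v`. -/
def IsSPE (G : Game P V) (v₀ : V) (σ : G.toArena.Profile) : Prop :=
  ∀ (h : List V) (v : V), G.toArena.IsHistFrom v₀ (h ++ [v]) →
    (G.restrict h).IsNE v (σ.restrict h)

/-- The cost profile `p` is Pareto optimal in `Plays(v₀)`: it is minimal, for the componentwise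
order, among the cost profiles of the plays from `v₀`. -/
def IsParetoOptimal (G : Game P V) (v₀ : V) (p : P → ℕ∞) : Prop :=
  Minimal (fun q => q ∈ G.costProfile '' G.toArena.playsFrom v₀) p

end Game

/-- A quantitative reachability game: an arena with a target set for each player. -/
structure ReachGame (P V : Type*) extends Arena P V where
  target : P → Set V

namespace ReachGame

variable {P V : Type*}

open Classical in
/-- The number of edges until the first visit to the target set of player `i`, `+∞` if there is
no such visit. -/
noncomputable def reachCost (G : ReachGame P V) (i : P) (ρ : ℕ → V) : ℕ∞ :=
  if hk : ∃ k, ρ k ∈ G.target i then (Nat.find hk : ℕ∞) else ⊤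

/-- The game underlying a quantitative reachability game. -/
noncomputable def toGame (G : ReachGame P V) : Game P V where
  toArena := G.toArena
  cost := G.reachCost

/-- The players who visit their target set along `ρ`. -/
def visit (G : ReachGame P V) (ρ : ℕ → V) : Set P :=
  {i | ∃ n, ρ n ∈ G.target i}

/-- The extended game: vertices are equipped with the set of players who have already visited
their target sets. -/
def extended (G : ReachGame P V) : ReachGame P (V × Set P) where
  Edge x y := G.Edge x.1 y.1 ∧ y.2 = x.2 ∪ {i | y.1 ∈ G.target i}
  exists_edge x := by
    obtain ⟨w, hw⟩ := G.exists_edge x.1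
    exact ⟨(w, x.2 ∪ {i | w ∈ G.target i}), hw, rfl⟩
  owner x := G.owner x.1
  target i := {x | i ∈ x.2}

/-- The initial vertex `(v₀, Visit(v₀))` of the extended game. -/
def extendedInit (G : ReachGame P V) (v₀ : V) : V × Set P :=
  (v₀, {i | v₀ ∈ G.target i})

end ReachGame

/-! Bound on costs: suppose a play with Pareto optimal costs first meets the target of player i at a
step c > |V|·|Π|. Before c at most |Π| - 1 players have visited their targets, so two steps before c
share both the vertex and the set of visitors. Deleting the cycle between them raises no cost and
lowers that of i (`exists_play_of_cycle`), against minimality. In the extended game, the vertex of G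
and the set of visitors determine the vertex along a play (`extended_eq_of_visited_eq`), so counting
with |V| still suffices.

Lasso: once all players who ever visit have done so, some vertex repeats within |V| further steps,
say at steps m < n. The profile `Profile.loop` plays as σ on a rewritten past: whenever the
rewritten history is that of the outcome of σ at step n, it is replaced by the one at step m. A
history consistent with the new profile up to deviations of i is rewritten to one consistent with σ
up to deviations of i, no longer and with the same last vertex. A deviation profitable against the
new profile would thus be profitable against σ (`isNE_loop`); no punishing strategies are needed.
For subgames (`isSPE_loop`), either the rewritten history lies on the outcome of σ, where the
equilibrium at the root decides, or it has left the first n steps of that outcome, and the new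
profile then copies a subgame of σ. -/

namespace Arena

/-! ### Configurations and unilateral deviations -/

variable {P V : Type*} {A : Arena P V}

/-- One step of all players following `σ`, from the history `c.1` ending in front of `c.2`. -/
def Profile.step (σ : A.Profile) (c : List V × V) : List V × V :=
  (c.1 ++ [c.2], (σ (A.owner c.2)).next c.1 c.2)

/-- One step in which all players except possibly `i` follow `σ`. -/
def Profile.DevStep (σ : A.Profile) (i : P) (c d : List V × V) : Prop :=
  d.1 = c.1 ++ [c.2] ∧ A.Edge c.2 d.2 ∧
    (A.owner c.2 ≠ i → d.2 = (σ (A.owner c.2)).next c.1 c.2)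

/-- Finitely many steps in which all players except possibly `i` follow `σ`. -/
def Profile.DevReach (σ : A.Profile) (i : P) : List V × V → List V × V → Prop :=
  Relation.ReflTransGen (σ.DevStep i)

theorem Profile.edge_step (σ : A.Profile) (c : List V × V) : A.Edge c.2 (σ.step c).2 :=
  (σ (A.owner c.2)).legal _ _ rfl

theorem Profile.devStep_step (σ : A.Profile) (i : P) (c : List V × V) :
    σ.DevStep i c (σ.step c) :=
  ⟨rfl, σ.edge_step c, fun _ => rfl⟩

theorem Profile.devReach_iterate (σ : A.Profile) (i : P) (c : List V × V) (n : ℕ) :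
    σ.DevReach i c (σ.step^[n] c) := by
  induction n with
  | zero => exact .refl
  | succ n ih =>
    rw [Function.iterate_succ_apply']
    exact ih.tail (σ.devStep_step i _)

theorem Profile.length_iterate (σ : A.Profile) (c : List V × V) (n : ℕ) :
    (σ.step^[n] c).1.length = c.1.length + n := by
  induction n with
  | zero => simp
  | succ n ih =>
    rw [Function.iterate_succ_apply']
    simp [Profile.step, ih, add_assoc]

theorem Profile.run_eq_iterate (σ : A.Profile) (v : V) (n : ℕ) :
    σ.run v n = σ.step^[n] ([], v) := by
  induction n with
  | zero => rfl
  | succ n ih => rw [Function.iterate_succ_apply', ← ih]; rfl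

theorem Profile.outcome_eq (σ : A.Profile) (v : V) (n : ℕ) :
    σ.outcome v n = (σ.step^[n] ([], v)).2 := by
  rw [← σ.run_eq_iterate]; rfl

theorem Profile.outcome_mem_playsFrom (σ : A.Profile) (v : V) : σ.outcome v ∈ A.playsFrom v := by
  refine ⟨fun k => ?_, rfl⟩
  rw [σ.outcome_eq, σ.outcome_eq, Function.iterate_succ_apply']
  exact σ.edge_step _

theorem Profile.iterate_step_restrict (σ : A.Profile) (h : List V) (c : List V × V) (n : ℕ) :
    σ.step^[n] (h ++ c.1, c.2) =
      (h ++ ((σ.restrict h).step^[n] c).1, ((σ.restrict h).step^[n] c).2) := by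
  induction n with
  | zero => rfl
  | succ n ih =>
    rw [Function.iterate_succ_apply', Function.iterate_succ_apply', ih]
    simp [Profile.step, Profile.restrict, Strategy.restrict]

theorem Profile.outcome_restrict (σ : A.Profile) (h : List V) (v : V) (n : ℕ) :
    (σ.restrict h).outcome v n = (σ.step^[n] (h, v)).2 := by
  have := σ.iterate_step_restrict h ([], v) n
  rw [List.append_nil] at this
  rw [this, Profile.outcome_eq]

open Classical in
theorem Profile.devStep_update (σ : A.Profile) (i : P) (s : A.Strategy i) (c : List V × V) :
    σ.DevStep i c (Profile.step (Function.update σ i s) c) := by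
  refine ⟨rfl, Profile.edge_step _ c, fun hne => ?_⟩
  simp [Profile.step, Function.update_of_ne hne]

open Classical in
theorem Profile.devReach_update (σ : A.Profile) (i : P) (s : A.Strategy i) (c : List V × V)
    (n : ℕ) : σ.DevReach i c ((Profile.step (Function.update σ i s))^[n] c) := by
  induction n with
  | zero => exact .refl
  | succ n ih =>
    rw [Function.iterate_succ_apply']
    exact ih.tail (σ.devStep_update i s _)

open Classical in
theorem Profile.step_update_of_eq (σ : A.Profile) {i : P} (s : A.Strategy i) {c : List V × V}
    (hc : A.owner c.2 = i) :
    Profile.step (Function.update σ i s) c = (c.1 ++ [c.2], s.next c.1 c.2) := by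
  subst hc
  simp [Profile.step]

open Classical in
theorem Profile.step_update_of_ne (σ : A.Profile) {i : P} (s : A.Strategy i) {c : List V × V}
    (hc : A.owner c.2 ≠ i) : Profile.step (Function.update σ i s) c = σ.step c := by
  simp [Profile.step, Function.update_of_ne hc]

open Classical in
/-- Player `i` can realise every history that is consistent with the strategies of the others. -/
theorem Profile.DevReach.exists_strategy {σ : A.Profile} {i : P} {c d : List V × V}
    (hd : σ.DevReach i c d) :
    ∃ (s : A.Strategy i) (n : ℕ), (Profile.step (Function.update σ i s))^[n] c = d := by
  induction hd with
  | refl => exact ⟨σ i, 0, rfl⟩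
  | @tail d e hcd hde ih =>
    obtain ⟨s, n, hs⟩ := ih
    obtain ⟨h1, h2, h3⟩ := hde
    -- Changing `s` at the single history of `d` cannot affect the way to `d`, since all earlier
    -- histories are shorter.
    obtain ⟨s', hs'⟩ : ∃ s' : A.Strategy i,
        ∀ h v, s'.next h v = if h = d.1 ∧ v = d.2 then e.2 else s.next h v :=
      ⟨{ next := fun h v => if h = d.1 ∧ v = d.2 then e.2 else s.next h v
         legal := fun h v hv => by
          split_ifs with hc
          · rw [hc.2]; exact h2
          · exact s.legal h v hv }, fun _ _ => rfl⟩
    have hle : ∀ k ≤ n, (Profile.step (Function.update σ i s'))^[k] c =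
        (Profile.step (Function.update σ i s))^[k] c := by
      intro k
      induction k with
      | zero => simp
      | succ k ih =>
        intro hk
        rw [Function.iterate_succ_apply', Function.iterate_succ_apply', ih (by omega)]
        set x := (Profile.step (Function.update σ i s))^[k] c with hx
        have hne : x.1 ≠ d.1 := by
          intro he
          have l1 := Profile.length_iterate (Function.update σ i s) c k
          have l2 := Profile.length_iterate (Function.update σ i s) c n
          rw [hs, ← he, hx] at l2
          omega
        by_cases ho : A.owner x.2 = i
        · rw [σ.step_update_of_eq _ ho, σ.step_update_of_eq _ ho, hs', if_neg (fun h => hne h.1)]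
        · rw [σ.step_update_of_ne _ ho, σ.step_update_of_ne _ ho]
    refine ⟨s', n + 1, ?_⟩
    rw [Function.iterate_succ_apply', hle n le_rfl, hs]
    by_cases ho : A.owner d.2 = i
    · rw [σ.step_update_of_eq _ ho, hs', if_pos ⟨rfl, rfl⟩, ← h1]
    · rw [σ.step_update_of_ne _ ho, Profile.step, ← h3 ho, ← h1]

open Classical in
theorem Profile.restrict_update (σ : A.Profile) (i : P) (s : A.Strategy i) (h : List V) :
    Profile.restrict (A := A) (Function.update σ i s) h =
      Function.update (σ.restrict h) i (s.restrict h) := by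
  funext j
  by_cases hj : j = i
  · subst hj; simp [Profile.restrict]
  · simp [Profile.restrict, Function.update_of_ne hj]

theorem Profile.DevReach.of_restrict {σ : A.Profile} {i : P} {h : List V} {c d : List V × V}
    (hd : (σ.restrict h).DevReach i c d) : σ.DevReach i (h ++ c.1, c.2) (h ++ d.1, d.2) := by
  refine Relation.ReflTransGen.lift (fun e : List V × V => (h ++ e.1, e.2)) (fun c d => ?_) _ _ hd
  rintro ⟨h1, h2, h3⟩
  exact ⟨by simp [h1], h2, h3⟩

theorem IsHist.snoc {h : List V} {u w : V} (hh : A.IsHist (h ++ [u])) (hw : A.Edge u w) :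
    A.IsHist (h ++ [u] ++ [w]) := by
  refine ⟨by simp, ?_⟩
  rw [List.isChain_append]
  refine ⟨hh.2, by simp, ?_⟩
  simpa using hw

theorem IsHistFrom.snoc {h : List V} {v₀ u w : V} (hh : A.IsHistFrom v₀ (h ++ [u]))
    (hw : A.Edge u w) : A.IsHistFrom v₀ (h ++ [u] ++ [w]) := by
  refine ⟨hh.1.snoc hw, ?_⟩
  rw [List.head?_append, hh.2]
  rfl

theorem isHistFrom_singleton (v₀ : V) : A.IsHistFrom v₀ ([] ++ [v₀]) :=
  ⟨⟨by simp, by simp⟩, rfl⟩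

theorem Profile.isHistFrom_iterate (σ : A.Profile) (v₀ : V) (n : ℕ) :
    A.IsHistFrom v₀ ((σ.step^[n] ([], v₀)).1 ++ [(σ.step^[n] ([], v₀)).2]) := by
  induction n with
  | zero => exact isHistFrom_singleton v₀
  | succ n ih =>
    rw [Function.iterate_succ_apply']
    exact ih.snoc (σ.edge_step _)

theorem IsPlay.isChain_map_range {ρ : ℕ → V} (hρ : A.IsPlay ρ) (n : ℕ) :
    ((List.range n).map ρ).IsChain A.Edge := by
  rw [List.isChain_iff_getElem]
  intro k hk
  simpa using hρ k

end Arena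

/-! ### Infinite sequences with a prefix, and lassos -/

theorem exists_prepend_mem_iff {V : Type*} (h : List V) (ρ : ℕ → V) (T : Set V) {n : ℕ}
    (hn : h.length ≤ n) :
    (∃ k ≤ n, prepend h ρ k ∈ T) ↔ (∃ x ∈ h, x ∈ T) ∨ ∃ k, h.length + k ≤ n ∧ ρ k ∈ T := by
  constructor
  · rintro ⟨k, hk, hT⟩
    unfold prepend at hT
    split_ifs at hT with hlt
    · exact .inl ⟨_, List.getElem_mem hlt, hT⟩
    · exact .inr ⟨_, by omega, hT⟩
  · rintro (⟨x, hx, hT⟩ | ⟨k, hk, hT⟩)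
    · obtain ⟨k, hk, rfl⟩ := List.getElem_of_mem hx
      exact ⟨k, by omega, by simpa [prepend, hk] using hT⟩
    · exact ⟨h.length + k, hk, by simpa [prepend] using hT⟩

theorem prepend_nil {V : Type*} (ρ : ℕ → V) : prepend [] ρ = ρ := by
  funext n; simp [prepend]

/-- An ultimately periodic sequence is of the form `hℓ^ω`. -/
theorem eq_prepend_omegaPow {V : Type*} (ρ : ℕ → V) (a p : ℕ)
    (hρ : ∀ n, a ≤ n → ρ (n + p) = ρ n)
    (hl : (List.range p).map (fun j => ρ (a + j)) ≠ []) :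
    ρ = prepend ((List.range a).map ρ)
      (omegaPow ((List.range p).map (fun j => ρ (a + j))) hl) := by
  funext n
  unfold prepend omegaPow
  split_ifs with hn
  · simp
  · simp only [List.length_map, List.length_range] at hn
    have hper : Function.Periodic (fun j => ρ (a + j)) p := fun j => by
      simpa [add_assoc] using hρ (a + j) (by omega)
    have := hper.map_mod_nat (n - a)
    simp only [List.length_map, List.length_range, List.getElem_map, List.getElem_range]
    rw [this]
    congr 1
    omega

/-! ### Equilibria in terms of reachable configurations -/

namespace ReachGame

variable {P V : Type*} (G : ReachGame P V)

theorem reachCost_le_iff (i : P) (ρ : ℕ → V) (n : ℕ) :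
    G.reachCost i ρ ≤ n ↔ ∃ k ≤ n, ρ k ∈ G.target i := by
  classical
  unfold reachCost
  split_ifs with h
  · rw [Nat.cast_le, Nat.find_le_iff]
  · simp only [top_le_iff, ENat.natCast_ne_top, false_iff]
    rintro ⟨k, -, hk⟩
    exact h ⟨k, hk⟩

theorem reachCost_le_of_forall {i : P} {ρ : ℕ → V} {x : ℕ∞}
    (h : ∀ n, ρ n ∈ G.target i → x ≤ n) : x ≤ G.reachCost i ρ := by
  classical
  unfold reachCost
  split_ifs with hk
  · exact h _ (Nat.find_spec hk)
  · exact le_top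

open Arena

/-- A profile is a Nash equilibrium in the subgame after `hv` if and only if no player reaches his
target set, by a unilateral deviation, before he does so when all players follow the profile. -/
theorem isNE_restrict_iff (σ : G.toArena.Profile) (h : List V) (v : V) :
    (G.toGame.restrict h).IsNE v (σ.restrict h) ↔
      ∀ (i : P) (c : List V × V), σ.DevReach i (h, v) c → c.2 ∈ G.target i →
        (∃ x ∈ h, x ∈ G.target i) ∨
          ∃ k, h.length + k ≤ c.1.length ∧ (σ.step^[k] (h, v)).2 ∈ G.target i := by
  classical
  constructor
  · intro hNE i c hc hT
    obtain ⟨s, n, rfl⟩ := hc.exists_strategy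
    have h1 : G.reachCost i (prepend h ((σ.restrict h).outcome v)) ≤
        G.reachCost i (prepend h (Profile.outcome (A := G.toArena)
          (Function.update (σ.restrict h) i (s.restrict h)) v)) := hNE i (s.restrict h)
    have h2 : G.reachCost i (prepend h ((Profile.restrict (A := G.toArena)
        (Function.update σ i s) h).outcome v)) ≤ ((h.length + n : ℕ) : ℕ∞) := by
      rw [reachCost_le_iff, exists_prepend_mem_iff _ _ _ (by omega)]
      exact .inr ⟨n, le_rfl, by rw [Profile.outcome_restrict]; exact hT⟩
    rw [Profile.restrict_update] at h2
    have h3 := h1.trans h2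
    rw [reachCost_le_iff, exists_prepend_mem_iff _ _ _ (by omega)] at h3
    rw [Profile.length_iterate]
    simpa only [Profile.outcome_restrict] using h3
  · intro H i s
    change G.reachCost i (prepend h ((σ.restrict h).outcome v)) ≤
      G.reachCost i (prepend h (Profile.outcome (A := G.toArena)
        (Function.update (σ.restrict h) i s) v))
    refine reachCost_le_of_forall G fun n hn => ?_
    rw [reachCost_le_iff]
    -- A visit inside `h` is common to the outcome and to every deviation.
    by_cases hlt : n < h.length
    · refine ⟨n, le_rfl, ?_⟩
      simpa [prepend, hlt] using hn
    · rw [exists_prepend_mem_iff _ _ _ (by omega)]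
      have hT : Profile.outcome (A := G.toArena) (Function.update (σ.restrict h) i s) v
          (n - h.length) ∈ G.target i := by simpa [prepend, hlt] using hn
      rw [Profile.outcome_eq] at hT
      have hr := ((σ.restrict h).devReach_update i s ([], v) (n - h.length)).of_restrict
      rw [List.append_nil] at hr
      have hlen : (h ++ ((Profile.step (A := G.toArena)
          (Function.update (σ.restrict h) i s))^[n - h.length] ([], v)).1).length = n := by
        rw [List.length_append, Profile.length_iterate, List.length_nil]
        omega
      simpa only [hlen, Profile.outcome_restrict] using H i _ hr hT

theorem isNE_iff (σ : G.toArena.Profile) (v : V) :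
    G.toGame.IsNE v σ ↔
      ∀ (i : P) (c : List V × V), σ.DevReach i ([], v) c → c.2 ∈ G.target i →
        ∃ k ≤ c.1.length, σ.outcome v k ∈ G.target i := by
  have hG : G.toGame.restrict [] = G.toGame := by
    simp only [Game.restrict, prepend_nil]
  have hNE : G.toGame.IsNE v σ ↔ (G.toGame.restrict []).IsNE v (σ.restrict []) := by
    have hσ : σ.restrict [] = σ := rfl
    unfold Game.IsNE Game.restrict
    simp only [prepend_nil, hσ]
  rw [hNE, isNE_restrict_iff]
  simp [Profile.outcome_eq]

end ReachGame

/-! ### Folding histories -/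

namespace Arena

variable {P V : Type*} {A : Arena P V}

open Classical in
/-- The past `h` of the vertex `v`, replaced by that of the configuration `a` if `hv` is the
history of the configuration `b`. -/
noncomputable def redirect (a b : List V × V) (h : List V) (v : V) : List V :=
  if h = b.1 ∧ v = b.2 then a.1 else h

/-- The history obtained from `h` by going back to `a` whenever `b` is reached. -/
noncomputable def foldHist (a b : List V × V) (h : List V) : List V :=
  h.foldl (fun l v => redirect a b l v ++ [v]) []

/-- The configuration `c`, or `a` if `c` is `b`. -/
noncomputable def collapse (a b c : List V × V) : List V × V :=
  (redirect a b c.1 c.2, c.2)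

/-- The configuration obtained from `c` by going back to `a` whenever `b` is reached. -/
noncomputable def foldConfig (a b c : List V × V) : List V × V :=
  collapse a b (foldHist a b c.1, c.2)

/-- The profile that plays as `σ` does, but goes back to the configuration `a` whenever `b` is
reached. -/
noncomputable def Profile.fold (σ : A.Profile) (a b : List V × V) : A.Profile := fun i =>
  { next := fun h v => (σ i).next (redirect a b (foldHist a b h) v) v
    legal := fun _ v hv => (σ i).legal _ v hv }

variable {a b : List V × V}

@[simp] theorem foldConfig_snd (c : List V × V) : (foldConfig a b c).2 = c.2 := rfl

theorem collapse_self (hab : a.2 = b.2) : collapse a b b = a := by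
  simp [collapse, redirect, ← hab]

theorem collapse_of_ne {c : List V × V} (hc : c ≠ b) : collapse a b c = c := by
  have : ¬ (c.1 = b.1 ∧ c.2 = b.2) := fun h => hc (Prod.ext h.1 h.2)
  simp [collapse, redirect, this]

/-- Folding proceeds step by step: the next folded configuration depends only on the current one and
the new vertex. -/
theorem foldConfig_snoc (c : List V × V) (w : V) :
    foldConfig a b (c.1 ++ [c.2], w) =
      collapse a b ((foldConfig a b c).1 ++ [(foldConfig a b c).2], w) := by
  simp [foldConfig, collapse, foldHist]

theorem foldConfig_nil (hb : b.1 ≠ []) (v : V) : foldConfig a b ([], v) = ([], v) := by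
  refine collapse_of_ne fun h => hb ?_
  rw [← h]; rfl

theorem length_collapse_le (hab : a.1.length ≤ b.1.length) (c : List V × V) :
    (collapse a b c).1.length ≤ c.1.length := by
  by_cases hc : c = b
  · subst hc
    simpa [collapse, redirect] using hab
  · rw [collapse_of_ne hc]

/-- The folded profile consults σ at the folded configuration, so its steps follow those of σ up to
a jump from `b` to `a`. -/
theorem foldConfig_step (σ : A.Profile) (c : List V × V) :
    foldConfig a b ((σ.fold a b).step c) = collapse a b (σ.step (foldConfig a b c)) :=
  foldConfig_snoc c _

theorem Profile.DevStep.of_fold {σ : A.Profile} {i : P} {c d : List V × V}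
    (h : (σ.fold a b).DevStep i c d) :
    ∃ e, σ.DevStep i (foldConfig a b c) e ∧ foldConfig a b d = collapse a b e := by
  obtain ⟨h1, h2, h3⟩ := h
  refine ⟨((foldConfig a b c).1 ++ [(foldConfig a b c).2], d.2), ⟨rfl, h2, h3⟩, ?_⟩
  rw [← foldConfig_snoc, ← h1]

theorem Profile.DevStep.length_eq {σ : A.Profile} {i : P} {c d : List V × V}
    (h : σ.DevStep i c d) : d.1.length = c.1.length + 1 := by
  simp [h.1]

/-- The length of the folded history grows at most as fast as that of the history. -/
theorem Profile.DevReach.length_foldConfig_add_le {σ : A.Profile} {i : P} {c d : List V × V}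
    (hab : a.1.length ≤ b.1.length) (h : (σ.fold a b).DevReach i c d) :
    (foldConfig a b d).1.length + c.1.length ≤ d.1.length + (foldConfig a b c).1.length := by
  induction h with
  | refl => omega
  | tail _ hde ih =>
    obtain ⟨e, he, heq⟩ := hde.of_fold
    have h1 := he.length_eq
    have h2 := hde.length_eq
    have h3 := length_collapse_le hab e
    rw [heq]
    omega

/-- Histories consistent with the folded profile fold to histories consistent with the profile. -/
theorem Profile.DevReach.of_fold {σ : A.Profile} {i : P} {o c d : List V × V}
    (hab : a.2 = b.2) (ha : σ.DevReach i o a) (hc : σ.DevReach i o (foldConfig a b c))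
    (h : (σ.fold a b).DevReach i c d) : σ.DevReach i o (foldConfig a b d) := by
  induction h with
  | refl => exact hc
  | tail _ hde ih =>
    obtain ⟨e, he, heq⟩ := hde.of_fold
    rw [heq]
    by_cases hb : e = b
    · rw [hb, collapse_self hab]; exact ha
    · rw [collapse_of_ne hb]; exact ih.tail he

theorem not_prefix_snoc {h l : List V} (hl : ¬ h <+: l) (v : V) : ¬ h ++ [v] <+: l :=
  fun hp => hl ((List.prefix_append h [v]).trans hp)

theorem ne_of_not_prefix {c : List V × V} (hc : ¬ c.1 ++ [c.2] <+: b.1 ++ [b.2]) : c ≠ b := by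
  rintro rfl
  exact hc (List.prefix_refl _)

/-- Away from the history `b`, folding does nothing. -/
theorem Profile.DevReach.foldConfig_of_not_prefix {σ : A.Profile} {i : P} {c d : List V × V}
    (hc : ¬ (foldConfig a b c).1 ++ [(foldConfig a b c).2] <+: b.1 ++ [b.2])
    (h : (σ.fold a b).DevReach i c d) :
    σ.DevReach i (foldConfig a b c) (foldConfig a b d) ∧
      ¬ (foldConfig a b d).1 ++ [(foldConfig a b d).2] <+: b.1 ++ [b.2] ∧
      (foldConfig a b d).1.length + c.1.length = d.1.length + (foldConfig a b c).1.length := by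
  induction h with
  | refl => exact ⟨.refl, hc, add_comm _ _⟩
  | tail _ hde ih =>
    obtain ⟨h1, h2, h3⟩ := ih
    obtain ⟨e, he, heq⟩ := hde.of_fold
    have hp : ¬ e.1 ++ [e.2] <+: b.1 ++ [b.2] := by
      rw [he.1]; exact not_prefix_snoc h2 _
    have l1 := he.length_eq
    have l2 := hde.length_eq
    rw [heq, collapse_of_ne (ne_of_not_prefix hp)]
    exact ⟨h1.tail he, hp, by omega⟩

theorem foldConfig_iterate_of_not_prefix (σ : A.Profile) {c : List V × V}
    (hc : ¬ (foldConfig a b c).1 ++ [(foldConfig a b c).2] <+: b.1 ++ [b.2]) (n : ℕ) :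
    foldConfig a b ((σ.fold a b).step^[n] c) = σ.step^[n] (foldConfig a b c) := by
  induction n with
  | zero => rfl
  | succ n ih =>
    rw [Function.iterate_succ_apply', Function.iterate_succ_apply', foldConfig_step, ih]
    refine collapse_of_ne (ne_of_not_prefix ?_)
    refine not_prefix_snoc ?_ _
    rw [← ih]
    -- Any player would do: a run without deviation is consistent whoever may deviate.
    exact (((σ.fold a b).devReach_iterate (A.owner c.2) c n).foldConfig_of_not_prefix hc).2.1

/-- The folded history is still too short to be that of `b`, so no jump occurs. -/
theorem foldConfig_iterate_of_lt (σ : A.Profile) (c : List V × V) (n : ℕ)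
    (hn : (foldConfig a b c).1.length + n < b.1.length) :
    foldConfig a b ((σ.fold a b).step^[n] c) = σ.step^[n] (foldConfig a b c) := by
  induction n with
  | zero => rfl
  | succ n ih =>
    rw [Function.iterate_succ_apply', foldConfig_step, ih (by omega),
      ← Function.iterate_succ_apply' (f := σ.step)]
    refine collapse_of_ne fun h => ?_
    have := σ.length_iterate (foldConfig a b c) (n + 1)
    rw [h] at this
    omega

/-- A jump preserves the last vertex, so the next edge remains available. This makes subgame
perfection of σ applicable at folded histories. -/
theorem isHistFrom_foldConfig {v₀ : V} (hab : a.2 = b.2) (hb : b.1 ≠ [])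
    (ha : A.IsHistFrom v₀ (a.1 ++ [a.2])) (h : List V) (v : V)
    (hh : A.IsHistFrom v₀ (h ++ [v])) :
    A.IsHistFrom v₀ ((foldConfig a b (h, v)).1 ++ [(foldConfig a b (h, v)).2]) := by
  induction h using List.reverseRecOn generalizing v with
  | nil => rw [foldConfig_nil hb]; exact hh
  | append_singleton l u ih =>
    obtain ⟨⟨h1, h2⟩, h3⟩ := hh
    rw [List.isChain_append] at h2
    have hl : A.IsHistFrom v₀ (l ++ [u]) := by
      refine ⟨⟨by simp, h2.1⟩, ?_⟩
      rw [List.head?_append] at h3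
      cases l <;> simpa using h3
    have huv : A.Edge u v := by simpa using h2.2.2
    have := foldConfig_snoc (a := a) (b := b) (l, u) v
    rw [this]
    by_cases hc : ((foldConfig a b (l, u)).1 ++ [(foldConfig a b (l, u)).2], v) = b
    · rw [hc, collapse_self hab]; exact ha
    · rw [collapse_of_ne hc]
      exact (ih u hl).snoc huv

/-- Every prefix of the history of a run is the history of an earlier configuration. -/
theorem Profile.exists_iterate_of_prefix (σ : A.Profile) (v₀ : V) (n : ℕ) (c : List V × V)
    (hc : c.1 ++ [c.2] <+: (σ.step^[n] ([], v₀)).1 ++ [(σ.step^[n] ([], v₀)).2]) :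
    ∃ m ≤ n, c = σ.step^[m] ([], v₀) := by
  induction n with
  | zero =>
    refine ⟨0, le_rfl, ?_⟩
    obtain ⟨t, ht⟩ := hc
    have hl := congrArg List.length ht
    obtain ⟨l, v⟩ := c
    simp only [Function.iterate_zero, id, List.length_append, List.length_singleton,
      List.length_nil] at hl
    obtain rfl : l = [] := List.length_eq_zero_iff.mp (by omega)
    obtain rfl : t = [] := List.length_eq_zero_iff.mp (by omega)
    simpa using ht
  | succ n ih =>
    rcases List.prefix_concat_iff.mp hc with h | h
    · refine ⟨n + 1, le_rfl, ?_⟩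
      have := List.append_inj' h rfl
      exact Prod.ext this.1 (by simpa using this.2)
    · rw [Function.iterate_succ_apply'] at h
      obtain ⟨m, hm, h⟩ := ih h
      exact ⟨m, hm.trans n.le_succ, h⟩

end Arena

/-! ### Looping the outcome of a profile -/

namespace Arena

variable {P V : Type*} {A : Arena P V}

/-- The configuration reached after `n` steps from `v`. -/
def Profile.config (σ : A.Profile) (v : V) (n : ℕ) : List V × V :=
  σ.step^[n] ([], v)

theorem Profile.config_succ (σ : A.Profile) (v : V) (n : ℕ) :
    σ.config v (n + 1) = σ.step (σ.config v n) :=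
  Function.iterate_succ_apply' _ _ _

theorem Profile.config_add (σ : A.Profile) (v : V) (n k : ℕ) :
    σ.config v (n + k) = σ.step^[k] (σ.config v n) := by
  rw [add_comm]
  exact Function.iterate_add_apply _ _ _ _

theorem Profile.length_config (σ : A.Profile) (v : V) (n : ℕ) :
    (σ.config v n).1.length = n := by
  rw [Profile.config, σ.length_iterate]
  simp

theorem Profile.config_snd (σ : A.Profile) (v : V) (n : ℕ) :
    (σ.config v n).2 = σ.outcome v n :=
  (σ.outcome_eq v n).symm

theorem Profile.config_ne_nil (σ : A.Profile) (v : V) {n : ℕ} (hn : 0 < n) :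
    (σ.config v n).1 ≠ [] := fun h => by
  have := σ.length_config v n
  rw [h, List.length_nil] at this
  omega

/-- The profile that plays as `σ` does, but whose outcome from `v` forever repeats the part of the
outcome of `σ` between steps `m` and `n`. -/
noncomputable def Profile.loop (σ : A.Profile) (v : V) (m n : ℕ) : A.Profile :=
  σ.fold (σ.config v m) (σ.config v n)

theorem Profile.DevReach.length_le {σ : A.Profile} {i : P} {c d : List V × V}
    (h : σ.DevReach i c d) : c.1.length ≤ d.1.length := by
  induction h with
  | refl => exact le_rfl
  | tail _ hde ih => rw [hde.length_eq]; omega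

variable (σ : A.Profile) (v : V) {m n : ℕ}

theorem foldConfig_loop_config_of_lt {k : ℕ} (hk : k < n) :
    foldConfig (σ.config v m) (σ.config v n) ((σ.loop v m n).config v k) = σ.config v k := by
  have hnil := foldConfig_nil (a := σ.config v m) (σ.config_ne_nil v (n := n) (by omega)) v
  have := foldConfig_iterate_of_lt (a := σ.config v m) (b := σ.config v n) σ ([], v) k
  rw [hnil, σ.length_config] at this
  exact this (by simpa using hk)

theorem loop_outcome_of_lt {k : ℕ} (hk : k < n) :
    (σ.loop v m n).outcome v k = σ.outcome v k := by
  rw [← Profile.config_snd, ← Profile.config_snd, ← foldConfig_loop_config_of_lt σ v (m := m) hk]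
  rfl

/-- At step `n` the run reaches `b` and is sent back to `a`, its folded configuration at step `m`;
from there the evolution is deterministic. -/
theorem foldConfig_loop_config_add (hmn : m < n) (he : σ.outcome v m = σ.outcome v n) (k : ℕ) :
    foldConfig (σ.config v m) (σ.config v n) ((σ.loop v m n).config v (n + k)) =
      foldConfig (σ.config v m) (σ.config v n) ((σ.loop v m n).config v (m + k)) := by
  induction k with
  | zero =>
    obtain ⟨p, rfl⟩ : ∃ p, n = p + 1 := ⟨n - 1, by omega⟩
    rw [add_zero, add_zero, foldConfig_loop_config_of_lt σ v hmn, Profile.config_succ (σ.loop v m (p + 1)),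
      Profile.loop, foldConfig_step]
    have := foldConfig_loop_config_of_lt σ v (m := m) (n := p + 1) (k := p) (by omega)
    rw [Profile.loop] at this
    rw [this, ← σ.config_succ]
    exact collapse_self (by rw [Profile.config_snd, Profile.config_snd, he])
  | succ k ih =>
    rw [← add_assoc, ← add_assoc, Profile.config_succ, Profile.config_succ, Profile.loop,
      foldConfig_step, foldConfig_step]
    rw [Profile.loop] at ih
    rw [ih]

theorem loop_outcome_add (hmn : m < n) (he : σ.outcome v m = σ.outcome v n) (k : ℕ)
    (hk : m ≤ k) :
    (σ.loop v m n).outcome v (k + (n - m)) = (σ.loop v m n).outcome v k := by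
  have := congrArg Prod.snd (foldConfig_loop_config_add σ v hmn he (k - m))
  rw [foldConfig_snd, foldConfig_snd, Profile.config_snd, Profile.config_snd] at this
  convert this using 2 <;> omega

/-- Subtracting periods `n - m` leads back to a step before `n`. Hence the looped outcome meets no
target earlier than σ does. -/
theorem exists_le_loop_outcome_eq (hmn : m < n) (he : σ.outcome v m = σ.outcome v n) (k : ℕ) :
    ∃ j ≤ k, (σ.loop v m n).outcome v k = σ.outcome v j := by
  induction k using Nat.strong_induction_on with
  | _ k ih =>
    by_cases hk : k < n
    · exact ⟨k, le_rfl, loop_outcome_of_lt σ v hk⟩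
    · obtain ⟨j, hj, h⟩ := ih (k - (n - m)) (by omega)
      refine ⟨j, by omega, ?_⟩
      rw [← h, ← loop_outcome_add σ v hmn he (k - (n - m)) (by omega),
        Nat.sub_add_cancel (by omega)]

theorem exists_isLasso_loop (hmn : m < n) (he : σ.outcome v m = σ.outcome v n) :
    ∃ h l : List V, A.IsLasso ((σ.loop v m n).outcome v) h l ∧ histLength (h ++ l) = n - 1 := by
  set ρ := (σ.loop v m n).outcome v with hρ
  have hl : (List.range (n - m)).map (fun j => ρ (m + j)) ≠ [] := by
    simp only [ne_eq, List.map_eq_nil_iff, List.range_eq_nil]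
    omega
  have happ : (List.range m).map ρ ++ (List.range (n - m)).map (fun j => ρ (m + j)) =
      (List.range n).map ρ := by
    conv_rhs => rw [show n = m + (n - m) by omega, List.range_add, List.map_append, List.map_map]
    rfl
  refine ⟨(List.range m).map ρ, (List.range (n - m)).map (fun j => ρ (m + j)), ⟨?_, hl, ?_⟩, ?_⟩
  · rw [happ]
    refine ⟨?_, ((σ.loop v m n).outcome_mem_playsFrom v).1.isChain_map_range n⟩
    simp only [ne_eq, List.map_eq_nil_iff, List.range_eq_nil]
    omega
  · exact eq_prepend_omegaPow ρ m (n - m) (fun k hk => loop_outcome_add σ v hmn he k hk) hl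
  · rw [happ]
    simp [histLength]

end Arena

/-! ### Looping preserves costs and equilibria -/

namespace ReachGame

open Arena

variable {P V : Type*} (G : ReachGame P V) (σ : G.toArena.Profile) (v : V) {m n : ℕ}

theorem reachCost_loop (hmn : m < n) (he : σ.outcome v m = σ.outcome v n) (i : P)
    (hi : ∀ k, σ.outcome v k ∈ G.target i → ∃ j ≤ m, σ.outcome v j ∈ G.target i) :
    G.reachCost i ((σ.loop v m n).outcome v) = G.reachCost i (σ.outcome v) := by
  refine le_antisymm (reachCost_le_of_forall G fun k hk => ?_)
    (reachCost_le_of_forall G fun k hk => ?_)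
  · rw [reachCost_le_iff]
    obtain ⟨j, hj, hT⟩ := hi k hk
    by_cases hjk : j ≤ k
    · exact ⟨j, hjk, by rwa [loop_outcome_of_lt σ v (by omega)]⟩
    · exact ⟨k, le_rfl, by rwa [loop_outcome_of_lt σ v (by omega)]⟩
  · rw [reachCost_le_iff]
    obtain ⟨j, hj, hT⟩ := exists_le_loop_outcome_eq σ v hmn he k
    exact ⟨j, hj, hT ▸ hk⟩

theorem devReach_foldConfig_loop {σ : G.toArena.Profile} {v : V}
    (he : σ.outcome v m = σ.outcome v n) {i : P}
    {c d : List V × V} (hc : σ.DevReach i ([], v) (foldConfig (σ.config v m) (σ.config v n) c))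
    (hd : (σ.loop v m n).DevReach i c d) :
    σ.DevReach i ([], v) (foldConfig (σ.config v m) (σ.config v n) d) :=
  .of_fold (by rw [Profile.config_snd, Profile.config_snd, he]) (σ.devReach_iterate i _ m) hc hd

theorem length_foldConfig_loop_add_le {σ : G.toArena.Profile} {v : V} (hmn : m < n) {i : P}
    {c d : List V × V} (hd : (σ.loop v m n).DevReach i c d) :
    (foldConfig (σ.config v m) (σ.config v n) d).1.length + c.1.length ≤
      d.1.length + (foldConfig (σ.config v m) (σ.config v n) c).1.length :=
  hd.length_foldConfig_add_le (by rw [Profile.length_config, Profile.length_config]; exact hmn.le)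

theorem isNE_loop (hmn : m < n) (he : σ.outcome v m = σ.outcome v n)
    (hm : ∀ i k, σ.outcome v k ∈ G.target i → ∃ j ≤ m, σ.outcome v j ∈ G.target i)
    (hσ : G.toGame.IsNE v σ) : G.toGame.IsNE v (σ.loop v m n) := by
  rw [isNE_iff] at hσ ⊢
  intro i c hc hT
  have hnil := foldConfig_nil (a := σ.config v m) (σ.config_ne_nil v (n := n) (by omega)) v
  have h1 := G.devReach_foldConfig_loop he (by rw [hnil]; exact .refl) hc
  have h2 := length_foldConfig_loop_add_le G hmn hc
  rw [hnil] at h2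
  rw [← reachCost_le_iff, reachCost_loop G σ v hmn he i (hm i), reachCost_le_iff]
  obtain ⟨k, hk, h⟩ := hσ i _ h1 hT
  simp only [List.length_nil, add_zero] at h2
  exact ⟨k, hk.trans h2, h⟩

/-- The target sets cannot be left. -/
def Absorbing : Prop :=
  ∀ i u w, G.Edge u w → u ∈ G.target i → w ∈ G.target i

variable {G}

theorem Absorbing.mono (hG : G.Absorbing) {ρ : ℕ → V} (hρ : G.IsPlay ρ) {i : P} {j k : ℕ}
    (hjk : j ≤ k) (hj : ρ j ∈ G.target i) : ρ k ∈ G.target i := by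
  induction k, hjk using Nat.le_induction with
  | base => exact hj
  | succ k _ ih => exact hG i _ _ (hρ k) ih

theorem Absorbing.mem_of_isChain (hG : G.Absorbing) {h : List V} {u : V} {i : P}
    (hh : (h ++ [u]).IsChain G.Edge) {x : V} (hx : x ∈ h) (hT : x ∈ G.target i) :
    u ∈ G.target i := by
  induction h using List.reverseRecOn generalizing u with
  | nil => simp at hx
  | append_singleton l y ih =>
    rw [List.isChain_append] at hh
    have hyu : G.Edge y u := by simpa using hh.2.2
    refine hG i y u hyu ?_
    rcases List.mem_append.mp hx with hx | hx
    · exact ih hh.1 hx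
    · rw [List.mem_singleton] at hx
      exact hx ▸ hT

/-- Since targets are absorbing, a visit in the folded past is still seen at the current vertex. -/
theorem isSPE_loop (hG : G.Absorbing) (hmn : m < n) (he : σ.outcome v m = σ.outcome v n)
    (hm : ∀ i k, σ.outcome v k ∈ G.target i → ∃ j ≤ m, σ.outcome v j ∈ G.target i)
    (hσ : G.toGame.IsSPE v σ) : G.toGame.IsSPE v (σ.loop v m n) := by
  have hNE := (isNE_restrict_iff G σ [] v).mp (hσ [] v (isHistFrom_singleton v))
  intro h u hu
  refine (isNE_restrict_iff G _ h u).mpr ?_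
  intro i c hc hT
  have he' : (σ.config v m).2 = (σ.config v n).2 := by
    rw [Profile.config_snd, Profile.config_snd, he]
  have hb := σ.config_ne_nil v (n := n) (by omega)
  -- If the folded history is on the outcome of σ, the deviation is compared with that outcome from
  -- the root.
  by_cases hp : (foldConfig (σ.config v m) (σ.config v n) (h, u)).1 ++
      [(foldConfig (σ.config v m) (σ.config v n) (h, u)).2] <+:
        (σ.config v n).1 ++ [(σ.config v n).2]
  · obtain ⟨p, hpn, hp⟩ := σ.exists_iterate_of_prefix v n _ hp
    change _ = σ.config v p at hp
    have h1 := G.devReach_foldConfig_loop he (by rw [hp]; exact σ.devReach_iterate i _ p) hc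
    have h2 := length_foldConfig_loop_add_le G hmn hc
    have hu2 : u = σ.outcome v p := by
      rw [← Profile.config_snd, ← hp]; rfl
    obtain ⟨k, hk, hkT⟩ : ∃ k ≤ (foldConfig (σ.config v m) (σ.config v n) c).1.length,
        σ.outcome v k ∈ G.target i := by
      have := hNE i _ h1 hT
      simpa [Profile.outcome_eq] using this
    obtain ⟨j, hj, hjT⟩ := hm i k hkT
    -- A visit by step `m` falls before the jump at `n`, where the looped profile still agrees with
    -- σ.
    obtain ⟨q, hqm, hqk, hqT⟩ : ∃ q ≤ m, q ≤ k ∧ σ.outcome v q ∈ G.target i := by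
      by_cases hjk : j ≤ k
      · exact ⟨j, hj, hjk, hjT⟩
      · exact ⟨k, by omega, le_rfl, hkT⟩
    right
    rw [hp, Profile.length_config] at h2
    by_cases hqp : q ≤ p
    · refine ⟨0, ?_, ?_⟩
      · simpa using hc.length_le
      · have := hG.mono (σ.outcome_mem_playsFrom v).1 hqp hqT
        rw [← hu2] at this
        exact this
    · refine ⟨q - p, by simp only at h2; omega, ?_⟩
      have h3 := foldConfig_iterate_of_lt (a := σ.config v m) (b := σ.config v n) σ (h, u) (q - p)
        (by rw [hp, Profile.length_config, Profile.length_config]; omega)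
      rw [hp, ← Profile.config_add, Nat.add_sub_cancel' (by omega)] at h3
      have h4 := congrArg Prod.snd h3
      rw [foldConfig_snd, Profile.config_snd] at h4
      rw [Profile.loop, h4]
      exact hqT
  -- No jump occurs any more, so elapsed times agree exactly with those after the folded history.
  · obtain ⟨h1, -, h2⟩ := hc.foldConfig_of_not_prefix hp
    have hhist := isHistFrom_foldConfig he' hb (σ.isHistFrom_iterate v m) h u hu
    have h3 := (isNE_restrict_iff G σ _ _).mp (hσ _ _ hhist)
    right
    rcases h3 i _ h1 hT with ⟨x, hx, hxT⟩ | ⟨k, hk, hkT⟩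
    · exact ⟨0, by simpa using hc.length_le, hG.mem_of_isChain hhist.1.2 hx hxT⟩
    · refine ⟨k, by simp only at h2 hk; omega, ?_⟩
      have h4 := congrArg Prod.snd (foldConfig_iterate_of_not_prefix σ hp k)
      rw [foldConfig_snd] at h4
      rw [Profile.loop, h4]
      exact hkT

end ReachGame

/-! ### Pareto optimality and short cycles -/

namespace ReachGame

open Arena

variable {P V W : Type*} (G : ReachGame P W)

open Classical in
/-- The players who visit their target set along the first `n` edges of `ρ`. -/
noncomputable def visited [Fintype P] (ρ : ℕ → W) (n : ℕ) : Finset P :=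
  {i | ∃ k ≤ n, ρ k ∈ G.target i}

theorem mem_visited [Fintype P] (ρ : ℕ → W) (n : ℕ) (i : P) :
    i ∈ G.visited ρ n ↔ ∃ k ≤ n, ρ k ∈ G.target i := by
  simp [visited]

theorem visited_mono [Fintype P] (ρ : ℕ → W) : Monotone (G.visited ρ) := by
  intro a b hab i
  rw [mem_visited, mem_visited]
  rintro ⟨k, hk, h⟩
  exact ⟨k, hk.trans hab, h⟩

variable {G}

/-- Removing a cycle along which no new player visits his target set. -/
theorem exists_play_of_cycle [Fintype P] {v : W} {ρ : ℕ → W} (hρ : ρ ∈ G.playsFrom v) {a b : ℕ}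
    (hab : a < b) (he : ρ a = ρ b) (hv : G.visited ρ a = G.visited ρ b) :
    ∃ ρ' ∈ G.playsFrom v, (∀ i, G.reachCost i ρ' ≤ G.reachCost i ρ) ∧
      ∀ i c, b < c → ρ c ∈ G.target i → G.reachCost i ρ' < c := by
  -- The two formulas agree at `k = a` because `ρ a = ρ b`.
  have hlate : ∀ k, a ≤ k → (if k ≤ a then ρ k else ρ (k + (b - a))) = ρ (k + (b - a)) := by
    intro k hk
    split_ifs with h
    · obtain rfl : k = a := le_antisymm h hk
      rw [he, Nat.add_sub_cancel' hab.le]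
    · rfl
  refine ⟨fun k => if k ≤ a then ρ k else ρ (k + (b - a)), ⟨fun k => ?_, ?_⟩, fun i => ?_, ?_⟩
  · by_cases hk : k + 1 ≤ a
    · simpa [hk, Nat.le_of_succ_le hk] using hρ.1 k
    · have h1 := hlate k (by omega)
      have h2 := hlate (k + 1) (by omega)
      simp only [h1, h2]
      rw [show k + 1 + (b - a) = k + (b - a) + 1 by omega]
      exact hρ.1 _
  · simpa using hρ.2
  · refine reachCost_le_of_forall G fun k hk => ?_
    rw [reachCost_le_iff]
    by_cases hkb : k ≤ b
    · have : i ∈ G.visited ρ a := by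
        rw [hv, mem_visited]
        exact ⟨k, hkb, hk⟩
      obtain ⟨j, hj, hT⟩ := (G.mem_visited ρ a i).mp this
      by_cases hjk : j ≤ k
      · exact ⟨j, hjk, by simpa [hj] using hT⟩
      · exact ⟨k, le_rfl, by simpa [show k ≤ a by omega] using hk⟩
    · refine ⟨k - (b - a), by omega, ?_⟩
      rw [hlate _ (by omega), Nat.sub_add_cancel (by omega)]
      exact hk
  · intro i c hc hT
    have : G.reachCost i (fun k => if k ≤ a then ρ k else ρ (k + (b - a))) ≤
        ((c - (b - a) : ℕ) : ℕ∞) := by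
      rw [reachCost_le_iff]
      refine ⟨c - (b - a), le_rfl, ?_⟩
      rw [hlate _ (by omega), Nat.sub_add_cancel (by omega)]
      exact hT
    refine this.trans_lt ?_
    rw [Nat.cast_lt]
    omega

/-- Costs are bounded in a play with Pareto optimal costs. The vertices are only distinguished by
`π` and the set of players who have visited their target sets. -/
theorem reachCost_le_of_isParetoOptimal [Fintype P] [Fintype V] {v : W} {ρ : ℕ → W} (π : W → V)
    (hρ : ρ ∈ G.playsFrom v) (hπ : ∀ a b, π (ρ a) = π (ρ b) → G.visited ρ a = G.visited ρ b →
      ρ a = ρ b)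
    (hpar : G.toGame.IsParetoOptimal v (G.toGame.costProfile ρ)) {i : P} (hi : i ∈ G.visit ρ) :
    G.reachCost i ρ ≤ ((Fintype.card V * Fintype.card P : ℕ) : ℕ∞) := by
  classical
  by_contra hlt
  obtain ⟨c, hc, hmin⟩ : ∃ c, ρ c ∈ G.target i ∧ ∀ k < c, ρ k ∉ G.target i :=
    ⟨Nat.find hi, Nat.find_spec hi, fun k hk => Nat.find_min hi hk⟩
  have hcard : Fintype.card V * Fintype.card P < c := by
    by_contra hle
    exact hlt ((G.reachCost_le_iff _ _ _).mpr ⟨c, not_lt.mp hle, hc⟩)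
  have hU : ∀ k < c, (G.visited ρ k).card < Fintype.card P := by
    intro k hk
    refine Finset.card_lt_univ_of_notMem (x := i) ?_
    rw [mem_visited]
    rintro ⟨j, hj, hT⟩
    exact hmin j (by omega) hT
  -- Recording only the size of the set of visitors leaves |Π| values; as these sets increase, equal
  -- sizes mean equal sets.
  obtain ⟨x, y, hxy, hf⟩ := Fintype.exists_ne_map_eq_of_card_lt
    (fun k : Fin c => (π (ρ k), (⟨_, hU k k.2⟩ : Fin (Fintype.card P)))) (by simpa using hcard)
  wlog hlt' : x < y generalizing x y
  · exact this y x hxy.symm hf.symm (lt_of_le_of_ne (not_lt.mp hlt') hxy.symm)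
  simp only [Prod.mk.injEq, Fin.mk.injEq] at hf
  have hv := Finset.eq_of_subset_of_card_le (G.visited_mono ρ hlt'.le) hf.2.ge
  obtain ⟨ρ', hρ', hle, hlt''⟩ := exists_play_of_cycle hρ hlt' (hπ _ _ hf.1 hv) hv
  have h1 : G.reachCost i ρ ≤ G.reachCost i ρ' :=
    hpar.2 (y := G.toGame.costProfile ρ') ⟨ρ', hρ', rfl⟩ hle i
  have h2 := h1.trans_lt (hlt'' i c y.2 hc)
  obtain ⟨n, hn⟩ := ENat.ne_top_iff_exists.mp h2.ne_top
  rw [← hn, Nat.cast_lt] at h2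
  obtain ⟨j, hj, hT⟩ := (G.reachCost_le_iff i ρ n).mp hn.ge
  exact hmin j (by omega) hT

/-- A cycle whose length is bounded, after all players who ever visit their target sets have done
so. -/
theorem exists_cycle_of_visit_le [Fintype P] [Fintype V] {ρ : ℕ → W} (π : W → V)
    (hπ : ∀ a b, π (ρ a) = π (ρ b) → G.visited ρ a = G.visited ρ b → ρ a = ρ b) {N : ℕ}
    (hN : ∀ i ∈ G.visit ρ, G.reachCost i ρ ≤ N) :
    ∃ m n, m < n ∧ n ≤ N + Fintype.card V ∧ ρ m = ρ n ∧
      ∀ i k, ρ k ∈ G.target i → ∃ j ≤ m, ρ j ∈ G.target i := by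
  have hN' : ∀ i k, ρ k ∈ G.target i → ∃ j ≤ N, ρ j ∈ G.target i := fun i k hk =>
    (G.reachCost_le_iff i ρ N).mp (hN i ⟨k, hk⟩)
  have hvis : ∀ k, N ≤ k → G.visited ρ k = G.visited ρ N := by
    intro k hk
    refine (G.visited_mono ρ hk).antisymm' fun i hi => ?_
    rw [mem_visited] at hi ⊢
    obtain ⟨j, -, hj⟩ := hi
    exact hN' i j hj
  -- The |V| + 1 steps from `N` to `N + |V|` all have the same set of visitors.
  obtain ⟨x, y, hxy, hf⟩ := Fintype.exists_ne_map_eq_of_card_lt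
    (fun k : Fin (Fintype.card V + 1) => π (ρ (N + k))) (by simp)
  wlog hlt : x < y generalizing x y
  · exact this y x hxy.symm hf.symm (lt_of_le_of_ne (not_lt.mp hlt) hxy.symm)
  refine ⟨N + x, N + y, by simpa using hlt, by omega, hπ _ _ hf ?_, fun i k hk => ?_⟩
  · rw [hvis (N + x) (by omega), hvis (N + y) (by omega)]
  · obtain ⟨j, hj, hT⟩ := hN' i k hk
    exact ⟨j, by omega, hT⟩

/-- From a profile with a Pareto optimal outcome, looping gives a profile with a short lasso as
outcome and the same costs. -/
theorem exists_loop_of_isParetoOptimal [Fintype P] [Fintype V] {v : W} {σ : G.toArena.Profile}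
    (π : W → V)
    (hπ : ∀ a b, π (σ.outcome v a) = π (σ.outcome v b) →
      G.visited (σ.outcome v) a = G.visited (σ.outcome v) b → σ.outcome v a = σ.outcome v b)
    (hpar : G.toGame.IsParetoOptimal v (G.toGame.costProfile (σ.outcome v))) :
    ∃ m n, m < n ∧ σ.outcome v m = σ.outcome v n ∧
      (∀ i k, σ.outcome v k ∈ G.target i → ∃ j ≤ m, σ.outcome v j ∈ G.target i) ∧
      (∃ h l : List W, G.toArena.IsLasso ((σ.loop v m n).outcome v) h l ∧
        histLength (h ++ l) ≤ (Fintype.card P + 1) * Fintype.card V) ∧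
      G.toGame.costProfile (σ.outcome v) = G.toGame.costProfile ((σ.loop v m n).outcome v) := by
  obtain ⟨m, n, hmn, hn, he, hm⟩ := exists_cycle_of_visit_le π hπ fun i hi =>
    reachCost_le_of_isParetoOptimal π (σ.outcome_mem_playsFrom v) hπ hpar hi
  refine ⟨m, n, hmn, he, hm, ?_, ?_⟩
  · obtain ⟨h, l, hlasso, hlen⟩ := exists_isLasso_loop σ v hmn he
    refine ⟨h, l, hlasso, ?_⟩
    rw [hlen]
    calc n - 1 ≤ Fintype.card V * Fintype.card P + Fintype.card V := by omega
      _ = _ := by ring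
  · funext i
    exact (reachCost_loop G σ v hmn he i (hm i)).symm

theorem absorbing_extended (G : ReachGame P V) : G.extended.Absorbing := by
  rintro i u w ⟨-, h⟩ hu
  change i ∈ w.2
  rw [h]
  exact .inl hu

/-- By absorption, the second component of a vertex on a play is exactly the set of players who have
visited so far. This yields bounds in |V| instead of |V|·2^|Π|. -/
theorem extended_eq_of_visited_eq [Fintype P] (G : ReachGame P V) {ρ : ℕ → V × Set P}
    (hρ : G.extended.IsPlay ρ) {a b : ℕ} (h : (ρ a).1 = (ρ b).1)
    (hv : G.extended.visited ρ a = G.extended.visited ρ b) : ρ a = ρ b := by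
  have key : ∀ n i, i ∈ G.extended.visited ρ n ↔ i ∈ (ρ n).2 := by
    intro n i
    rw [mem_visited]
    refine ⟨?_, fun hi => ⟨n, le_rfl, hi⟩⟩
    rintro ⟨k, hk, hT⟩
    exact G.absorbing_extended.mono hρ hk hT
  refine Prod.ext h (Set.ext fun i => ?_)
  rw [← key, ← key, hv]

end ReachGame

theorem mainTheorem9 {P V : Type*} [Fintype P] [Fintype V] (G : ReachGame P V) (v₀ : V) :
    (∀ σ : G.toGame.toArena.Profile,
      G.toGame.IsNE v₀ σ →
      G.toGame.IsParetoOptimal v₀ (G.toGame.costProfile (σ.outcome v₀)) →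
        (∀ i ∈ G.visit (σ.outcome v₀),
          G.toGame.cost i (σ.outcome v₀) ≤ ((Fintype.card V * Fintype.card P : ℕ) : ℕ∞)) ∧
        ∃ τ : G.toGame.toArena.Profile,
          G.toGame.IsNE v₀ τ ∧
          (∃ h l : List V, G.toGame.toArena.IsLasso (τ.outcome v₀) h l ∧
            histLength (h ++ l) ≤ (Fintype.card P + 1) * Fintype.card V) ∧
          G.toGame.costProfile (σ.outcome v₀) = G.toGame.costProfile (τ.outcome v₀)) ∧
    (∀ σ : G.extended.toGame.toArena.Profile,
      G.extended.toGame.IsSPE (G.extendedInit v₀) σ →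
      G.extended.toGame.IsParetoOptimal (G.extendedInit v₀)
        (G.extended.toGame.costProfile (σ.outcome (G.extendedInit v₀))) →
        (∀ i ∈ G.extended.visit (σ.outcome (G.extendedInit v₀)),
          G.extended.toGame.cost i (σ.outcome (G.extendedInit v₀)) ≤
            ((Fintype.card V * Fintype.card P : ℕ) : ℕ∞)) ∧
        ∃ τ : G.extended.toGame.toArena.Profile,
          G.extended.toGame.IsSPE (G.extendedInit v₀) τ ∧
          (∃ h l : List (V × Set P),
            G.extended.toGame.toArena.IsLasso (τ.outcome (G.extendedInit v₀)) h l ∧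
            histLength (h ++ l) ≤ (Fintype.card P + 1) * Fintype.card V) ∧
          G.extended.toGame.costProfile (σ.outcome (G.extendedInit v₀)) =
            G.extended.toGame.costProfile (τ.outcome (G.extendedInit v₀))) := by
  constructor
  · intro σ hσ hpar
    have hπ : ∀ a b, id (σ.outcome v₀ a) = id (σ.outcome v₀ b) →
        G.visited (σ.outcome v₀) a = G.visited (σ.outcome v₀) b →
        σ.outcome v₀ a = σ.outcome v₀ b := fun _ _ h _ => h
    refine ⟨fun i hi => ReachGame.reachCost_le_of_isParetoOptimal id
      (σ.outcome_mem_playsFrom v₀) hπ hpar hi, ?_⟩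
    obtain ⟨m, n, hmn, he, hm, hlasso, hcost⟩ :=
      ReachGame.exists_loop_of_isParetoOptimal id hπ hpar
    exact ⟨σ.loop v₀ m n, G.isNE_loop σ v₀ hmn he hm hσ, hlasso, hcost⟩
  · intro σ hσ hpar
    have hplay := σ.outcome_mem_playsFrom (G.extendedInit v₀)
    have hπ : ∀ a b, (σ.outcome (G.extendedInit v₀) a).1 = (σ.outcome (G.extendedInit v₀) b).1 →
        G.extended.visited (σ.outcome (G.extendedInit v₀)) a =
          G.extended.visited (σ.outcome (G.extendedInit v₀)) b →
        σ.outcome (G.extendedInit v₀) a = σ.outcome (G.extendedInit v₀) b :=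
      fun _ _ => G.extended_eq_of_visited_eq hplay.1
    refine ⟨fun i hi => ReachGame.reachCost_le_of_isParetoOptimal Prod.fst hplay hπ hpar hi, ?_⟩
    obtain ⟨m, n, hmn, he, hm, hlasso, hcost⟩ :=
      ReachGame.exists_loop_of_isParetoOptimal Prod.fst hπ hpar
    exact ⟨σ.loop _ m n, ReachGame.isSPE_loop σ _ G.absorbing_extended hmn he hm hσ, hlasso,
      hcost⟩
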